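/- **Notation.** For $a\in\mathbb{C}$ and $\ell\in\mathbb{Z}_{\ge 0}$ let $(a)_\ell=a(a+1)\cdots(a+\ell-1)$, with $(a)_0=1$. Let ${}_1F_1(a;b;z)=\sum_{n\ge 0}\frac{(a)_n}{(b)_n\,n!}z^n$ be Kummer's confluent hypergeometric function, and for $z>0$ let $U(a,b,z)$ be Tricomi's confluent hypergeometric function, i.e. the entire function of $a\in\mathbb{C}$ which for $\operatorname{Re}a>0$ is given by $U(a,b,z)=\frac{1}{\Gamma(a)}\int_0^\infty e^{-zt}\,t^{a-1}(1+t)^{b-a-1}\,dt$. For $x>0$ the Whittaker functions are $$M_{\kappa,\mu}(x)=e^{-x/2}x^{1/2+\mu}\,{}_1F_1\!\left(\mu-\kappa+\tfrac12;\,2\mu+1;\,x\right),\qquad W_{\kappa,\mu}(x)=e^{-x/2}x^{1/2+\mu}\,U\!\left(\mu-\kappa+\tfrac12,\,2\mu+1,\,x\right).$$ Powers of positive reals are taken as $x^{s}=e^{s\log x}$ with real $\log x$. **Theorem.** Let $0\le r_0<r$ and $\kappa,\mu\in\mathbb{C}$ with $\operatorname{Re}\mu>0$. Then $$\frac{1}{(r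 r_0)^{\mu+1/2}}\sum_{\ell=0}^{\infty}(-1)^\ell\,\frac{(\mu-\kappa+\frac12)_\ell}{(\ell+2\mu)_\ell\,\ell!}\,M_{\kappa,\ell+\mu}(r_0)\,W_{\kappa,\ell+\mu}(r)=\frac{1}{(r+r_0)^{\mu+1/2}}\,W_{\kappa,\mu}(r+r_0).$$ For $r_0>0$ the series converges absolutely. For $r_0=0$ the equation is understood as a limiting case: as $r_0\downarrow 0$ the left-hand side tends to $r^{-\mu-1/2}W_{\kappa,\mu}(r)$; moreover each term of the series, multiplied by $(r r_0)^{-\mu-1/2}$, has a limit as $r_0\downarrow 0$, and the series of these limits converges to $r^{-\mu-1/2}W_{\kappa,\mu}(r)$. -/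

import Mathlib

open Set Filter Topology MeasureTheory

noncomputable section

namespace Whittaker

/-- The integrand `e^{-zt} t^{a-1} (1+t)^{b-a-1}` of the Laplace integral for `U(a, b, z)`. -/
def tricomiIntegrand (a b z : ℂ) (t : ℝ) : ℂ :=
  Complex.exp (-z * t) * (t : ℂ) ^ (a - 1) * (1 + t : ℂ) ^ (b - a - 1)

/-- `(1 / Γ(a)) ∫₀^∞ e^{-zt} t^{a-1} (1+t)^{b-a-1} dt`, which is `U(a, b, z)` when `Re a > 0`
and `Re z > 0`. -/
def tricomiIntegral (a b z : ℂ) : ℂ :=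
  (Complex.Gamma a)⁻¹ * ∫ t in Ioi (0 : ℝ), tricomiIntegrand a b z t

lemma tricomi_aux_tendsto (c x : ℝ) (hx : 0 < x) :
    Tendsto (fun t : ℝ => (1 + t) ^ c * Real.exp (-x * t)) atTop (𝓝 0) := by
  have h := (tendsto_rpow_mul_exp_neg_mul_atTop_nhds_zero c x hx).comp
    (tendsto_atTop_add_const_left atTop (1 : ℝ) tendsto_id)
  have h2 := h.const_mul (Real.exp x)
  rw [mul_zero] at h2
  refine h2.congr fun t => ?_
  simp only [Function.comp, id]
  rw [show -x * (1 + t) = -x + -x * t by ring, Real.exp_add, Real.exp_neg]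
  field_simp

lemma tricomiIntegrand_norm (a b z : ℂ) {t : ℝ} (ht : 0 < t) :
    ‖tricomiIntegrand a b z t‖ =
      Real.exp (-z.re * t) * t ^ (a.re - 1) * (1 + t) ^ (b.re - a.re - 1) := by
  have h1 : (1 + t : ℂ) = ((1 + t : ℝ) : ℂ) := by push_cast; rfl
  rw [tricomiIntegrand, h1, norm_mul, norm_mul, Complex.norm_exp,
    Complex.norm_cpow_eq_rpow_re_of_pos ht, Complex.norm_cpow_eq_rpow_re_of_pos (by linarith)]
  simp

lemma tricomiIntegrand_continuousOn (a b z : ℂ) :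
    ContinuousOn (tricomiIntegrand a b z) (Ioi 0) := by
  intro t ht
  have ht' : (0 : ℝ) < t := ht
  have h1 : (t : ℂ) ∈ Complex.slitPlane := Complex.ofReal_mem_slitPlane.2 ht'
  have h2 : (1 + t : ℂ) ∈ Complex.slitPlane := by
    have : (1 + t : ℂ) = ((1 + t : ℝ) : ℂ) := by push_cast; rfl
    rw [this]; exact Complex.ofReal_mem_slitPlane.2 (by linarith)
  apply ContinuousAt.continuousWithinAt
  unfold tricomiIntegrand
  exact ((by fun_prop : ContinuousAt (fun t : ℝ => Complex.exp (-z * t)) t).mul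
    ((by fun_prop : ContinuousAt (fun t : ℝ => (t : ℂ)) t).cpow continuousAt_const h1)).mul
    ((by fun_prop : ContinuousAt (fun t : ℝ => (1 + t : ℂ)) t).cpow continuousAt_const h2)

lemma tricomiIntegrand_integrableOn (a b z : ℂ) (ha : 0 < a.re) (hz : 0 < z.re) :
    IntegrableOn (tricomiIntegrand a b z) (Ioi 0) := by
  have hf : ContinuousOn (fun t : ℝ => tricomiIntegrand 1 (b - a + 1) z t) (Ioi 0) :=
    tricomiIntegrand_continuousOn _ _ _
  have key : MellinConvergent (fun t : ℝ => tricomiIntegrand 1 (b - a + 1) z t) a := by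
    refine mellinConvergent_of_isBigO_rpow_exp (a := z.re / 2) (b := 0) (by linarith)
      (hf.locallyIntegrableOn measurableSet_Ioi) ?_ ?_ ha
    · have h := (tricomi_aux_tendsto (b.re - a.re - 1) (z.re / 2) (by linarith)).norm
      rw [norm_zero] at h
      have h2 := h.eventually (gt_mem_nhds one_pos)
      refine Asymptotics.IsBigO.of_bound 1 ?_
      filter_upwards [h2, eventually_gt_atTop 0] with t h3 ht
      rw [tricomiIntegrand_norm _ _ _ ht]
      rw [Real.norm_of_nonneg (by positivity)] at h3
      rw [Real.norm_of_nonneg (Real.exp_pos _).le]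
      have : Real.exp (-z.re * t) = Real.exp (-(z.re / 2) * t) * Real.exp (-(z.re / 2) * t) := by
        rw [← Real.exp_add]; ring_nf
      rw [this]
      simp only [Complex.one_re, sub_self, Real.rpow_zero, mul_one, Complex.add_re, Complex.sub_re,
        add_sub_cancel_right, one_mul]
      have e := Real.exp_pos (-(z.re / 2) * t)
      nlinarith
    · have hc : ContinuousWithinAt (fun t : ℝ =>
          Real.exp (-z.re * t) * (1 + t) ^ (b.re - a.re - 1)) (Ioi 0) 0 := by
        apply ContinuousAt.continuousWithinAt
        refine ContinuousAt.mul (by fun_prop) ?_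
        exact ContinuousAt.rpow_const (by fun_prop) (by simp)
      have h2 : ∀ᶠ t in 𝓝[>] (0 : ℝ),
          Real.exp (-z.re * t) * (1 + t) ^ (b.re - a.re - 1) < 2 := by
        refine hc.eventually (gt_mem_nhds ?_)
        simp
      refine Asymptotics.IsBigO.of_bound 2 ?_
      filter_upwards [h2, self_mem_nhdsWithin] with t h3 ht
      rw [tricomiIntegrand_norm _ _ _ ht]
      simp
      simpa using h3.le
  refine IntegrableOn.congr_fun key (fun t ht => ?_) measurableSet_Ioi
  simp only [tricomiIntegrand, smul_eq_mul, sub_self, Complex.cpow_zero]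
  ring_nf

lemma tricomiIntegral_step (a b z : ℂ) (ha : 0 < a.re) (hz : 0 < z.re) :
    z * tricomiIntegral (a + 1) (b + 1) z - (b - a - 1) * tricomiIntegral (a + 1) b z =
      tricomiIntegral a b z := by
  have ha0 : a ≠ 0 := by rintro rfl; simp at ha
  have i1 := tricomiIntegrand_integrableOn a b z ha hz
  have i2 := tricomiIntegrand_integrableOn (a + 1) (b + 1) z (by simp; linarith) hz
  have i3 := tricomiIntegrand_integrableOn (a + 1) b z (by simp; linarith) hz
  have hderiv : ∀ t ∈ Ioi (0 : ℝ), HasDerivAt (tricomiIntegrand (a + 1) (b + 1) z)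
      (a * tricomiIntegrand a b z t + (-z * tricomiIntegrand (a + 1) (b + 1) z t +
        (b - a - 1) * tricomiIntegrand (a + 1) b z t)) t := by
    intro t ht
    have ht' : (0 : ℝ) < t := ht
    have h1 : (t : ℂ) ∈ Complex.slitPlane := Complex.ofReal_mem_slitPlane.2 ht'
    have h2 : (1 + t : ℂ) ∈ Complex.slitPlane := by
      have : (1 + t : ℂ) = ((1 + t : ℝ) : ℂ) := by push_cast; rfl
      rw [this]; exact Complex.ofReal_mem_slitPlane.2 (by linarith)
    have d0 : HasDerivAt (fun t : ℝ => (t : ℂ)) 1 t := Complex.ofRealCLM.hasDerivAt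
    have d1 : HasDerivAt (fun t : ℂ => Complex.exp (-z * t) * t ^ (a + 1 - 1) *
        (1 + t) ^ (b + 1 - (a + 1) - 1)) _ (t : ℂ) :=
      ((((hasDerivAt_id' (t : ℂ)).const_mul (-z)).cexp).mul
        ((hasDerivAt_id' (t : ℂ)).cpow_const h1)).mul
        (((hasDerivAt_id' (t : ℂ)).const_add 1).cpow_const h2)
    have d2 := d1.comp_ofReal
    refine d2.congr_deriv ?_
    simp only [tricomiIntegrand, add_sub_cancel_right, Pi.mul_apply]
    rw [show b + 1 - (a + 1) - 1 = b - a - 1 by ring, show b - (a + 1) - 1 = b - a - 1 - 1 by ring]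
    ring
  have hint : IntegrableOn (fun t => a * tricomiIntegrand a b z t +
      (-z * tricomiIntegrand (a + 1) (b + 1) z t +
        (b - a - 1) * tricomiIntegrand (a + 1) b z t)) (Ioi 0) :=
    (i1.const_mul a).add ((i2.const_mul _).add (i3.const_mul _))
  have hcont : ContinuousWithinAt (tricomiIntegrand (a + 1) (b + 1) z) (Ici 0) 0 := by
    apply ContinuousAt.continuousWithinAt
    have e : tricomiIntegrand (a + 1) (b + 1) z = fun t : ℝ => Complex.exp (-z * t) * (t : ℂ) ^ a *
        (1 + t : ℂ) ^ (b - a - 1) := by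
      funext t; simp only [tricomiIntegrand]; ring_nf
    rw [e]
    refine ContinuousAt.mul (ContinuousAt.mul (by fun_prop) ?_) ?_
    · exact Complex.continuousAt_ofReal_cpow_const 0 a (Or.inl ha)
    · exact ContinuousAt.cpow (by fun_prop) continuousAt_const (by simp)
  have h0 : tricomiIntegrand (a + 1) (b + 1) z 0 = 0 := by
    simp [tricomiIntegrand, ha0]
  have htop : Tendsto (tricomiIntegrand (a + 1) (b + 1) z) atTop (𝓝 0) := by
    have m1 := tricomi_aux_tendsto (b.re - a.re - 1) (z.re / 2) (by linarith)
    have m2 := tendsto_rpow_mul_exp_neg_mul_atTop_nhds_zero a.re (z.re / 2) (by linarith)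
    have m := m1.mul m2
    rw [mul_zero] at m
    rw [tendsto_zero_iff_norm_tendsto_zero]
    refine m.congr' ?_
    filter_upwards [eventually_gt_atTop 0] with t ht
    rw [tricomiIntegrand_norm _ _ _ ht]
    have : Real.exp (-z.re * t) = Real.exp (-(z.re / 2) * t) * Real.exp (-(z.re / 2) * t) := by
      rw [← Real.exp_add]; ring_nf
    rw [this]
    simp only [Complex.add_re, Complex.one_re, add_sub_cancel_right]
    rw [show b.re + 1 - (a.re + 1) - 1 = b.re - a.re - 1 by ring]
    ring
  have main := integral_Ioi_of_hasDerivAt_of_tendsto hcont hderiv hint htop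
  have j1 : IntegrableOn (fun t => a * tricomiIntegrand a b z t) (Ioi 0) := i1.const_mul a
  have j2 : IntegrableOn (fun t => -z * tricomiIntegrand (a + 1) (b + 1) z t) (Ioi 0) :=
    i2.const_mul _
  have j3 : IntegrableOn (fun t => (b - a - 1) * tricomiIntegrand (a + 1) b z t) (Ioi 0) :=
    i3.const_mul _
  have j4 : IntegrableOn (fun t => -z * tricomiIntegrand (a + 1) (b + 1) z t +
      (b - a - 1) * tricomiIntegrand (a + 1) b z t) (Ioi 0) := j2.add j3
  rw [h0, sub_zero, integral_add j1 j4, integral_add j2 j3] at main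
  simp only [integral_const_mul] at main
  unfold tricomiIntegral
  rw [Complex.Gamma_add_one a ha0]
  have hG := Complex.Gamma_ne_zero_of_re_pos ha
  field_simp
  linear_combination -main

lemma tricomiIntegral_differentiableAt (a b z : ℂ) (ha : 0 < a.re) (hz : 0 < z.re) :
    DifferentiableAt ℂ (fun a => tricomiIntegral a b z) a := by
  have hG := Complex.differentiable_one_div_Gamma a
  refine hG.mul ?_
  set ε := a.re / 4 with hε
  have hε0 : 0 < ε := by positivity
  have hs : Metric.ball a (a.re / 2) ∈ 𝓝 a := Metric.ball_mem_nhds _ (by linarith)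
  have hmeas : ∀ a', AEStronglyMeasurable (tricomiIntegrand a' b z) (volume.restrict (Ioi 0)) :=
    fun a' => (tricomiIntegrand_continuousOn a' b z).aestronglyMeasurable measurableSet_Ioi
  refine (hasDerivAt_integral_of_dominated_loc_of_deriv_le
    (F := fun a t => tricomiIntegrand a b z t)
    (F' := fun a t => (Real.log (t / (1 + t)) : ℂ) * tricomiIntegrand a b z t)
    (bound := fun t => (1 / ε) * ‖tricomiIntegrand ε b z t‖) hs
    (Eventually.of_forall hmeas) (tricomiIntegrand_integrableOn a b z ha hz) ?_ ?_ ?_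
    ?_).2.differentiableAt
  · refine AEStronglyMeasurable.mul ?_ (hmeas a)
    exact (by fun_prop : Measurable fun t : ℝ => (Real.log (t / (1 + t)) : ℂ)).aestronglyMeasurable
  · refine (ae_restrict_iff' measurableSet_Ioi).2 (Eventually.of_forall fun t ht a' ha' => ?_)
    have ht' : (0 : ℝ) < t := ht
    rw [norm_mul, tricomiIntegrand_norm _ _ _ ht', tricomiIntegrand_norm _ _ _ ht']
    set u := t / (1 + t) with hu
    have hu0 : 0 < u := by positivity
    have hu1 : u ≤ 1 := by rw [hu, div_le_one (by positivity)]; linarith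
    have hre : 2 * ε ≤ a'.re := by
      rw [Metric.mem_ball, Complex.dist_eq] at ha'
      have := (Complex.abs_re_le_norm (a' - a)).trans_lt ha'
      rw [Complex.sub_re, abs_lt] at this
      linarith [this.1]
    have hlog := (Real.abs_log_mul_self_rpow_lt u ε hu0 hu1 hε0).le
    have e : ∀ s : ℝ, Real.exp (-z.re * t) * t ^ (s - 1) * (1 + t) ^ (b.re - s - 1) =
        u ^ (s - 1) * (Real.exp (-z.re * t) * (1 + t) ^ (b.re - 2)) := by
      intro s
      rw [hu, Real.div_rpow ht'.le (by positivity), show b.re - 2 = (b.re - s - 1) + (s - 1) by ring,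
        Real.rpow_add (by positivity)]
      have : (1 + t) ^ (s - 1) ≠ 0 := by positivity
      field_simp
    rw [e, e, Complex.ofReal_re, Complex.norm_real, Real.norm_eq_abs, ← mul_assoc, ← mul_assoc (1 / ε)]
    refine mul_le_mul_of_nonneg_right ?_
      (mul_nonneg (Real.exp_pos _).le (Real.rpow_nonneg (by linarith) _))
    have h3 : u ^ (a'.re - 1) ≤ u ^ ε * u ^ (ε - 1) := by
      rw [← Real.rpow_add hu0]
      exact Real.rpow_le_rpow_of_exponent_ge hu0 hu1 (by linarith)
    calc |Real.log u| * u ^ (a'.re - 1) ≤ |Real.log u| * (u ^ ε * u ^ (ε - 1)) := by gcongr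
      _ = |Real.log u * u ^ ε| * u ^ (ε - 1) := by
        rw [abs_mul, abs_of_pos (Real.rpow_pos_of_pos hu0 ε)]; ring
      _ ≤ _ := by gcongr
  · exact ((tricomiIntegrand_integrableOn ε b z (by simpa using hε0) hz).norm).const_mul _
  · refine (ae_restrict_iff' measurableSet_Ioi).2 (Eventually.of_forall fun t ht a' _ => ?_)
    have ht' : (0 : ℝ) < t := ht
    have h0 : (t : ℂ) ≠ 0 := by exact_mod_cast ht'.ne'
    have h1 : (1 + t : ℂ) = ((1 + t : ℝ) : ℂ) := by push_cast; rfl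
    have h2 : (1 + t : ℂ) ≠ 0 := by rw [h1]; exact_mod_cast (by linarith : (0:ℝ) < 1 + t).ne'
    have d := ((((hasDerivAt_id' a').sub_const 1).const_cpow (c := (t : ℂ)) (Or.inl h0)).const_mul
      (Complex.exp (-z * t))).mul
      ((((hasDerivAt_id' a').const_sub b).sub_const 1).const_cpow (c := (1 + t : ℂ)) (Or.inl h2))
    refine d.congr_deriv ?_
    rw [Real.log_div ht'.ne' (by positivity), Complex.ofReal_sub, Complex.ofReal_log ht'.le,
      Complex.ofReal_log (by positivity), ← h1]
    simp only [tricomiIntegrand]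
    ring

/-- Auxiliary: the integral continued holomorphically in `a` to `Re a > -n`, by `n` integrations
by parts. Used only to show that the analytic continuation in `a` exists. -/
def tricomiStep : ℕ → ℂ → ℂ → ℂ → ℂ
  | 0, a, b, z => tricomiIntegral a b z
  | n + 1, a, b, z => z * tricomiStep n (a + 1) (b + 1) z - (b - a - 1) * tricomiStep n (a + 1) b z

lemma tricomiStep_differentiableAt (n : ℕ) (a b z : ℂ) (ha : -(n : ℝ) < a.re) (hz : 0 < z.re) :
    DifferentiableAt ℂ (fun a => tricomiStep n a b z) a := by
  induction n generalizing a b with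
  | zero => exact tricomiIntegral_differentiableAt a b z (by simpa using ha) hz
  | succ n ih =>
    have h : -(n : ℝ) < (a + 1).re := by push_cast at ha; simp; linarith
    have s : DifferentiableAt ℂ (fun a : ℂ => a + 1) a := by fun_prop
    have i1 := DifferentiableAt.comp a (ih (a + 1) (b + 1) h) s
    have i2 := DifferentiableAt.comp a (ih (a + 1) b h) s
    exact (i1.const_mul z).sub
      ((by fun_prop : DifferentiableAt ℂ (fun a : ℂ => b - a - 1) a).mul i2)

lemma tricomiStep_succ (n : ℕ) (a b z : ℂ) (ha : -(n : ℝ) < a.re) (hz : 0 < z.re) :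
    tricomiStep (n + 1) a b z = tricomiStep n a b z := by
  induction n generalizing a b with
  | zero => exact tricomiIntegral_step a b z (by simpa using ha) hz
  | succ n ih =>
    have h : -(n : ℝ) < (a + 1).re := by push_cast at ha; simp; linarith
    rw [tricomiStep, ih _ _ h, ih _ _ h, tricomiStep]

lemma tricomiStep_add (n k : ℕ) (a b z : ℂ) (ha : -(n : ℝ) < a.re) (hz : 0 < z.re) :
    tricomiStep (n + k) a b z = tricomiStep n a b z := by
  induction k with
  | zero => rfl
  | succ k ih =>
    rw [← add_assoc, tricomiStep_succ _ _ _ _ (by push_cast; linarith [k.cast_nonneg (α := ℝ)]) hz,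
      ih]

/-- For `Re z > 0`, the Laplace integral extends from `Re a > 0` to an entire function of `a`. -/
theorem exists_tricomi_continuation (b z : ℂ) (hz : 0 < z.re) :
    ∃ F : ℂ → ℂ, Differentiable ℂ F ∧ ∀ a, 0 < a.re → F a = tricomiIntegral a b z := by
  have eq : ∀ (n : ℕ) (a : ℂ), -(n : ℝ) < a.re →
      tricomiStep (⌊-a.re⌋₊ + 1) a b z = tricomiStep n a b z := by
    intro n a ha
    have h1 : -((⌊-a.re⌋₊ + 1 : ℕ) : ℝ) < a.re := by
      push_cast; linarith [Nat.lt_floor_add_one (-a.re)]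
    rw [← tricomiStep_add _ n a b z h1 hz, ← tricomiStep_add n (⌊-a.re⌋₊ + 1) a b z ha hz, add_comm]
  refine ⟨fun a => tricomiStep (⌊-a.re⌋₊ + 1) a b z, fun a => ?_, fun a ha => ?_⟩
  · obtain ⟨n, hn⟩ := exists_nat_gt (-a.re)
    refine (tricomiStep_differentiableAt n a b z (by linarith) hz).congr_of_eventuallyEq ?_
    have : ∀ᶠ a' : ℂ in 𝓝 a, -(n : ℝ) < a'.re :=
      Complex.continuous_re.continuousAt.eventually (lt_mem_nhds (by linarith))
    filter_upwards [this] with a' h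
    exact eq n a' h
  · exact eq 0 a (by simpa using ha)

/-- Tricomi's confluent hypergeometric function `U(a, b, z)` for `Re z > 0` and all complex `a`,
`b`: the analytic continuation in `a` of the Laplace integral
`(1 / Γ(a)) ∫₀^∞ e^{-zt} t^{a-1} (1+t)^{b-a-1} dt`, `Re a > 0`, to the whole plane. (The value is
`0` by convention if `Re z ≤ 0`, where the function is not used.) -/
def tricomiU (a b z : ℂ) : ℂ :=
  if hz : 0 < z.re then (exists_tricomi_continuation b z hz).choose a else 0

theorem tricomiU_differentiable (b z : ℂ) (hz : 0 < z.re) :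
    Differentiable ℂ (fun a => tricomiU a b z) := by
  simpa only [tricomiU, dif_pos hz] using (exists_tricomi_continuation b z hz).choose_spec.1

theorem tricomiU_eq_integral (a b z : ℂ) (ha : 0 < a.re) (hz : 0 < z.re) :
    tricomiU a b z = tricomiIntegral a b z := by
  simpa only [tricomiU, dif_pos hz] using
    (exists_tricomi_continuation b z hz).choose_spec.2 a ha

/-- The analytic continuation is unique. -/
theorem tricomiU_unique (b z : ℂ) (hz : 0 < z.re) (F : ℂ → ℂ) (hF : Differentiable ℂ F)
    (h : ∀ a, 0 < a.re → F a = tricomiIntegral a b z) (a : ℂ) : F a = tricomiU a b z := by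
  have h1 : AnalyticOnNhd ℂ F univ := fun x _ => hF.analyticAt x
  have h2 : AnalyticOnNhd ℂ (fun a => tricomiU a b z) univ :=
    fun x _ => (tricomiU_differentiable b z hz).analyticAt x
  refine congrFun (h1.eq_of_eventuallyEq h2 (z₀ := 1) ?_) a
  have : ∀ᶠ a' : ℂ in 𝓝 1, 0 < a'.re :=
    Complex.continuous_re.continuousAt.eventually (lt_mem_nhds (by simp))
  filter_upwards [this] with a' ha'
  rw [h a' ha', tricomiU_eq_integral a' b z ha' hz]

/-- Kummer's function `₁F₁(a; b; z)`, for `b` not a nonpositive integer: Mathlib's regularized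
hypergeometric function multiplied by `Γ(b)`. -/
def kummerM (a b z : ℂ) : ℂ :=
  Complex.Gamma b * Complex.regularizedHGFun {a} {b} z

/-- `₁F₁(a; b; z) = ∑ (a)ₙ / ((b)ₙ n!) zⁿ`. -/
theorem kummerM_eq_tsum (a b z : ℂ) (hb : ∀ k : ℕ, b ≠ -k) :
    kummerM a b z = ∑' n : ℕ, (ascPochhammer ℂ n).eval a /
      ((ascPochhammer ℂ n).eval b * (n.factorial : ℂ)) * z ^ n := by
  have hG : Complex.Gamma b ≠ 0 := Complex.Gamma_ne_zero hb
  rw [kummerM, Complex.regularizedHGFun, FormalMultilinearSeries.sum, ← tsum_mul_left]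
  refine tsum_congr fun n => ?_
  rw [← Complex.Gamma_add_nat_div_Gamma_eq b hb]
  simp only [FormalMultilinearSeries.apply_eq_pow_smul_coeff, smul_eq_mul,
    Complex.regularizedHGFunSeries_coeff, Complex.regularizedHGFunCoeff, Multiset.map_singleton,
    Multiset.prod_singleton]
  field_simp

/-- The Whittaker function `M_{κ,μ}(x)`, `x > 0`. -/
def whittakerM (κ μ : ℂ) (x : ℝ) : ℂ :=
  Complex.exp (-x / 2) * (x : ℂ) ^ (1 / 2 + μ) * kummerM (μ - κ + 1 / 2) (2 * μ + 1) x

/-- The Whittaker function `W_{κ,μ}(x)`, `x > 0`. -/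
def whittakerW (κ μ : ℂ) (x : ℝ) : ℂ :=
  Complex.exp (-x / 2) * (x : ℂ) ^ (1 / 2 + μ) * tricomiU (μ - κ + 1 / 2) (2 * μ + 1) x

/-- `(-1)^ℓ (μ-κ+1/2)_ℓ / ((ℓ+2μ)_ℓ ℓ!) · M_{κ,ℓ+μ}(r₀) W_{κ,ℓ+μ}(r)`, where `(a)_ℓ` is the
rising factorial. -/
def summand (κ μ : ℂ) (r r₀ : ℝ) (ℓ : ℕ) : ℂ :=
  (-1) ^ ℓ * ((ascPochhammer ℂ ℓ).eval (μ - κ + 1 / 2) /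
    ((ascPochhammer ℂ ℓ).eval (ℓ + 2 * μ) * (ℓ.factorial : ℂ))) *
    whittakerM κ (ℓ + μ) r₀ * whittakerW κ (ℓ + μ) r

end Whittaker

end

noncomputable section

namespace Whittaker

/-! With a = μ - κ + 1/2 and b = 2μ + 1, removing exponentials and powers leaves an addition theorem
for U(a, b, z + x), where z = r, x = r₀ and Re b > 1.

Expanding e^{-xt} in the Laplace integral gives the Taylor series U(a, b, z + x) = ∑ₙ (-x)ⁿ/n! (a)ₙ
U(a+n, b+n, z) (`hasSum_tricomiU_add`). A three-term contiguous relation, iterated, writes (-1)ⁿ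
U(a+n, b+n, z) as a finite combination of (-z)^ℓ U(a+ℓ, b+2ℓ, z), ℓ ≤ n, with explicit coefficients
(`sum_expansionCoeff_mul_tricomiU`). Substituting and summing over n = ℓ + m for fixed ℓ produces
exactly the series of ₁F₁(a+ℓ; b+2ℓ; x).

The rearrangement needs an absolutely convergent double series. The bound `norm_tricomiU_le` makes
the factor in ℓ of size (x/z)^ℓ Γ(Re b - 1 + ℓ)/ℓ!, which is summable as x < z, while the ₁F₁ terms
are at most (Kx)^m/m! uniformly in ℓ. Identities in a are proved for Re a > 0 and continued, or
carried leftwards by a recurrence. -/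

/-! ### Contiguous relations for U -/

theorem eq_of_differentiable_of_eq_of_re_pos {F G : ℂ → ℂ} (hF : Differentiable ℂ F)
    (hG : Differentiable ℂ G) (h : ∀ a, 0 < a.re → F a = G a) (a : ℂ) : F a = G a := by
  have h1 : AnalyticOnNhd ℂ F univ := fun x _ => hF.analyticAt x
  have h2 : AnalyticOnNhd ℂ G univ := fun x _ => hG.analyticAt x
  refine congrFun (h1.eq_of_eventuallyEq h2 (z₀ := 1) ?_) a
  have : ∀ᶠ a' : ℂ in 𝓝 1, 0 < a'.re :=
    Complex.continuous_re.continuousAt.eventually (lt_mem_nhds (by simp))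
  exact this.mono h

theorem tricomiU_add_one_differentiable (b z : ℂ) (hz : 0 < z.re) :
    Differentiable ℂ (fun a => tricomiU (a + 1) b z) :=
  (tricomiU_differentiable b z hz).comp (by fun_prop : Differentiable ℂ fun a : ℂ => a + 1)

/-- For Re a > 0 this is an integration by parts; both sides are entire in a. It expresses U at a
through a + 1, so it also carries the Taylor series to the left. -/
theorem tricomiU_eq_raise_left (a b z : ℂ) (hz : 0 < z.re) :
    z * tricomiU (a + 1) (b + 1) z - (b - a - 1) * tricomiU (a + 1) b z = tricomiU a b z := by
  refine eq_of_differentiable_of_eq_of_re_pos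
    (F := fun a => z * tricomiU (a + 1) (b + 1) z - (b - a - 1) * tricomiU (a + 1) b z)
    (((tricomiU_add_one_differentiable _ z hz).const_mul z).sub
      ((by fun_prop : Differentiable ℂ fun a : ℂ => b - a - 1).mul
        (tricomiU_add_one_differentiable _ z hz)))
    (tricomiU_differentiable b z hz) (fun a ha => ?_) a
  have ha' : 0 < (a + 1).re := by simp; linarith
  simp only [tricomiU_eq_integral _ _ _ ha' hz, tricomiU_eq_integral _ _ _ ha hz]
  exact tricomiIntegral_step a b z ha hz

lemma one_add_ofReal_ne_zero {t : ℝ} (ht : 0 < t) : (1 + t : ℂ) ≠ 0 := by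
  exact_mod_cast (by positivity : (1 + t : ℝ) ≠ 0)

lemma tricomiIntegrand_add_one_right (a b z : ℂ) {t : ℝ} (ht : 0 < t) :
    tricomiIntegrand a (b + 1) z t =
      tricomiIntegrand a b z t + tricomiIntegrand (a + 1) (b + 1) z t := by
  have h0 : (t : ℂ) ≠ 0 := by exact_mod_cast ht.ne'
  simp only [tricomiIntegrand]
  rw [show b + 1 - a - 1 = (b - a - 1) + 1 by ring, show a + 1 - 1 = (a - 1) + 1 by ring,
    show b + 1 - (a + 1) - 1 = b - a - 1 by ring, Complex.cpow_add _ _ h0,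
    Complex.cpow_add _ _ (one_add_ofReal_ne_zero ht), Complex.cpow_one, Complex.cpow_one]
  ring

/-- Under the integral this is (1+t)^{b-a} = (1+t)^{b-a-1} (1 + t); the factor a comes from Γ(a+1) =
a Γ(a). -/
theorem tricomiU_add_one_right (a b z : ℂ) (hz : 0 < z.re) :
    tricomiU a (b + 1) z = tricomiU a b z + a * tricomiU (a + 1) (b + 1) z := by
  refine eq_of_differentiable_of_eq_of_re_pos
    (G := fun a => tricomiU a b z + a * tricomiU (a + 1) (b + 1) z)
    (tricomiU_differentiable _ z hz)
    ((tricomiU_differentiable b z hz).add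
      (differentiable_id.mul (tricomiU_add_one_differentiable _ z hz))) (fun a ha => ?_) a
  have ha' : 0 < (a + 1).re := by simp; linarith
  have ha0 : a ≠ 0 := by rintro rfl; simp at ha
  simp only [tricomiU_eq_integral _ _ _ ha' hz, tricomiU_eq_integral _ _ _ ha hz, tricomiIntegral]
  rw [setIntegral_congr_fun measurableSet_Ioi
      (fun t ht => tricomiIntegrand_add_one_right a b z ht),
    integral_add (tricomiIntegrand_integrableOn a b z ha hz)
      (tricomiIntegrand_integrableOn (a + 1) (b + 1) z ha' hz), Complex.Gamma_add_one a ha0]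
  field_simp

/-- Eliminate U(a, b+1, z) between the two preceding relations. -/
theorem tricomiU_contiguous (a b z : ℂ) (hz : 0 < z.re) :
    tricomiU a b z + b * tricomiU (a + 1) (b + 1) z = z * tricomiU (a + 1) (b + 2) z := by
  have h1 := tricomiU_eq_raise_left a (b + 1) z hz
  have h2 := tricomiU_add_one_right a b z hz
  rw [show b + 1 + 1 = b + 2 by ring] at h1
  linear_combination -h1 - h2

/-! ### Finite expansion of U(a+n, b+n, z) -/

lemma ascPochhammer_eval_ne_zero {b : ℂ} (hb : 0 < b.re) (n : ℕ) :
    (ascPochhammer ℂ n).eval b ≠ 0 := by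
  induction n with
  | zero => simp
  | succ n ih =>
    rw [ascPochhammer_succ_eval]
    refine mul_ne_zero ih fun h => ?_
    have := congrArg Complex.re h
    simp only [Complex.add_re, Complex.natCast_re, Complex.zero_re] at this
    linarith [n.cast_nonneg (α := ℝ)]

lemma ascPochhammer_eval_succ_left (n : ℕ) (b : ℂ) :
    (ascPochhammer ℂ (n + 1)).eval b = b * (ascPochhammer ℂ n).eval (b + 1) := by
  rw [ascPochhammer_succ_left]
  simp

lemma ascPochhammer_eval_add (m n : ℕ) (b : ℂ) :
    (ascPochhammer ℂ (m + n)).eval b =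
      (ascPochhammer ℂ m).eval b * (ascPochhammer ℂ n).eval (b + m) := by
  rw [← ascPochhammer_mul]
  simp

/-- The coefficients of the expansion of `U(a + n, b + n, z)` in `z ^ ℓ U(a + ℓ, b + 2ℓ, z)`. -/
def expansionCoeff (n ℓ : ℕ) (b : ℂ) : ℂ :=
  n.choose ℓ * (b + 2 * ℓ - 1) / (ascPochhammer ℂ (n + 1)).eval (b + ℓ - 1)

lemma expansionCoeff_of_lt {n ℓ : ℕ} (h : n < ℓ) (b : ℂ) : expansionCoeff n ℓ b = 0 := by
  simp [expansionCoeff, Nat.choose_eq_zero_of_lt h]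

lemma expansionCoeff_zero (n : ℕ) {b : ℂ} (hb : 1 < b.re) :
    expansionCoeff (n + 1) 0 b * (b + n) = expansionCoeff n 0 b := by
  have h := ascPochhammer_eval_ne_zero (b := b - 1) (by simpa using hb) (n + 2)
  rw [ascPochhammer_succ_eval] at h
  have h' := right_ne_zero_of_mul h
  have h'' := left_ne_zero_of_mul h
  simp only [expansionCoeff, Nat.choose_zero_right, Nat.cast_one, Nat.cast_zero, mul_zero, add_zero,
    one_mul]
  rw [ascPochhammer_succ_eval (n + 1)]
  push_cast at h' ⊢
  have : b + n ≠ 0 := by convert h' using 1; ring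
  rw [show b - 1 + (n + 1 : ℂ) = b + n by ring]
  field_simp

/-- This recurrence mirrors the contiguous relation at (a+n, b+n): one term keeps (a, b), the other
is the case (a+1, b+2) with ℓ shifted by one. -/
lemma expansionCoeff_succ (n ℓ : ℕ) {b : ℂ} (hb : 1 < b.re) :
    expansionCoeff (n + 1) (ℓ + 1) b * (b + n) =
      expansionCoeff n (ℓ + 1) b + expansionCoeff n ℓ (b + 2) := by
  have hre : 0 < (b + ℓ).re := by
    simp only [Complex.add_re, Complex.natCast_re]; linarith [ℓ.cast_nonneg (α := ℝ)]
  have h := ascPochhammer_eval_ne_zero hre (n + 2)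
  have e1 := ascPochhammer_succ_eval (S := ℂ) (n + 1) (b + ℓ)
  have e2 := ascPochhammer_eval_succ_left (n + 1) (b + ℓ)
  have hc : ((n.choose (ℓ + 1) : ℕ) : ℂ) * (ℓ + 1) = n.choose ℓ * (n - ℓ) := by
    rcases le_or_gt ℓ n with hl | hl
    · have := Nat.choose_succ_right_eq n ℓ
      have := congrArg (Nat.cast (R := ℂ)) this
      push_cast [Nat.cast_sub hl] at this
      exact this
    · simp [Nat.choose_eq_zero_of_lt hl, Nat.choose_eq_zero_of_lt (hl.trans (Nat.lt_succ_self ℓ))]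
  simp only [expansionCoeff, Nat.choose_succ_succ]
  push_cast
  rw [show b + (ℓ + 1 : ℂ) - 1 = b + ℓ by ring, show b + 2 + (ℓ : ℂ) - 1 = b + ℓ + 1 by ring,
    show b + 2 * (ℓ + 1 : ℂ) - 1 = b + 2 * ℓ + 1 by ring,
    show b + 2 + 2 * (ℓ : ℂ) - 1 = b + 2 * ℓ + 1 by ring]
  set P := (ascPochhammer ℂ (n + 1 + 1)).eval (b + ℓ)
  set Q := (ascPochhammer ℂ (n + 1)).eval (b + ℓ)
  set R := (ascPochhammer ℂ (n + 1)).eval (b + ℓ + 1)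
  have hQ : Q ≠ 0 := left_ne_zero_of_mul (e1 ▸ h)
  have hR : R ≠ 0 := right_ne_zero_of_mul (e2 ▸ h)
  -- Q and R are P without its last and first factor. Over the common denominator P only `hc`
  -- remains to be used.
  have i1 : 1 / Q = (b + ℓ + (n + 1 : ℕ)) / P := by
    rw [e1]; have := right_ne_zero_of_mul (e1 ▸ h); field_simp
  have i2 : 1 / R = (b + ℓ) / P := by
    rw [e2]; have := left_ne_zero_of_mul (e2 ▸ h); field_simp
  push_cast at i1
  rw [div_eq_mul_one_div _ Q, div_eq_mul_one_div _ R, i1, i2]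
  field_simp
  linear_combination (-(b + 2 * ℓ + 1)) * hc

theorem sum_expansionCoeff_mul_tricomiU (n : ℕ) (a b z : ℂ) (hb : 1 < b.re) (hz : 0 < z.re) :
    ∑ ℓ ∈ Finset.range (n + 1),
        expansionCoeff n ℓ b * ((-z) ^ ℓ * tricomiU (a + ℓ) (b + 2 * ℓ) z) =
      (-1) ^ n * tricomiU (a + n) (b + n) z := by
  induction n generalizing a b with
  | zero =>
    have : b - 1 ≠ 0 := fun h => by
      have := congrArg Complex.re h
      simp at this
      linarith
    simp [expansionCoeff, this]
  | succ n ih =>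
    have hbn : b + n ≠ 0 := fun h => by
      have := congrArg Complex.re h
      simp only [Complex.add_re, Complex.natCast_re, Complex.zero_re] at this
      linarith [n.cast_nonneg (α := ℝ)]
    have h1 := ih a b hb
    have h2 := ih (a + 1) (b + 2) (by simp; linarith)
    have hU := tricomiU_contiguous (a + n) (b + n) z hz
    rw [← mul_left_inj' hbn, Finset.sum_mul, Finset.sum_range_succ']
    -- The sum for n is padded with its vanishing term ℓ = n + 1, so that splitting off ℓ = 0 aligns
    -- it with the sum for n + 1.
    have e1 := Finset.sum_range_succ
      (fun ℓ => expansionCoeff n ℓ b * ((-z) ^ ℓ * tricomiU (a + ℓ) (b + 2 * ℓ) z)) (n + 1)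
    rw [expansionCoeff_of_lt (Nat.lt_succ_self n), zero_mul, add_zero, h1,
      Finset.sum_range_succ'] at e1
    have e2 : ∀ ℓ ∈ Finset.range (n + 1), expansionCoeff (n + 1) (ℓ + 1) b *
        ((-z) ^ (ℓ + 1) * tricomiU (a + (ℓ + 1 : ℕ)) (b + 2 * (ℓ + 1 : ℕ)) z) * (b + n) =
        expansionCoeff n (ℓ + 1) b *
          ((-z) ^ (ℓ + 1) * tricomiU (a + (ℓ + 1 : ℕ)) (b + 2 * (ℓ + 1 : ℕ)) z) +
        -z * (expansionCoeff n ℓ (b + 2) *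
          ((-z) ^ ℓ * tricomiU (a + 1 + ℓ) (b + 2 + 2 * ℓ) z)) := by
      intro ℓ _
      rw [show a + 1 + (ℓ : ℂ) = a + (ℓ + 1 : ℕ) by push_cast; ring,
        show b + 2 + 2 * (ℓ : ℂ) = b + 2 * (ℓ + 1 : ℕ) by push_cast; ring]
      linear_combination ((-z) ^ (ℓ + 1) * tricomiU (a + (ℓ + 1 : ℕ)) (b + 2 * (ℓ + 1 : ℕ)) z) *
        expansionCoeff_succ n ℓ hb
    rw [Finset.sum_congr rfl e2, Finset.sum_add_distrib, ← Finset.mul_sum, h2]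
    have e3 := expansionCoeff_zero n hb
    rw [show a + 1 + (n : ℂ) = a + n + 1 by ring, show b + 2 + (n : ℂ) = b + n + 2 by ring]
    rw [show a + ((n + 1 : ℕ) : ℂ) = a + n + 1 by push_cast; ring,
      show b + ((n + 1 : ℕ) : ℂ) = b + n + 1 by push_cast; ring]
    linear_combination e1 + (-1) ^ n * hU + ((-z) ^ 0 * tricomiU (a + (0 : ℕ)) (b + 2 * (0 : ℕ)) z) * e3

/-! ### Taylor expansion of U in z -/

lemma tricomiIntegrand_add_natCast (a b z : ℂ) (n : ℕ) {t : ℝ} (ht : 0 < t) :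
    tricomiIntegrand (a + n) (b + n) z t = (t : ℂ) ^ n * tricomiIntegrand a b z t := by
  have h0 : (t : ℂ) ≠ 0 := by exact_mod_cast ht.ne'
  simp only [tricomiIntegrand]
  rw [show a + n - 1 = (a - 1) + n by ring, show b + n - (a + n) - 1 = b - a - 1 by ring,
    Complex.cpow_add _ _ h0, Complex.cpow_natCast]
  ring

/-- No condition on a is needed: at the poles `Complex.Gamma` is 0, so its inverse agrees with the
entire function 1/Γ. -/
lemma inv_Gamma_eq_ascPochhammer_mul (a : ℂ) (n : ℕ) :
    (Complex.Gamma a)⁻¹ = (ascPochhammer ℂ n).eval a * (Complex.Gamma (a + n))⁻¹ := by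
  induction n with
  | zero => simp
  | succ n ih =>
    rw [ih, Complex.one_div_Gamma_eq_self_mul_one_div_Gamma_add_one (a + n),
      ascPochhammer_succ_eval]
    push_cast
    rw [add_assoc a]
    ring

/-- Expand e^{-xt} under the integral: tⁿ shifts both a and b by n. The absolute values sum to
e^{xt} times the norm of the integrand, i.e. the norm of the integrand at z - x, which is integrable
because x < z. -/
theorem hasSum_tricomiU_add_of_re_pos (a b : ℂ) (ha : 0 < a.re) {z x : ℝ} (hx : 0 ≤ x)
    (hxz : x < z) :
    HasSum (fun n : ℕ => (-x : ℂ) ^ n / n.factorial *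
        ((ascPochhammer ℂ n).eval a * tricomiU (a + n) (b + n) z))
      (tricomiU a b (z + x : ℝ)) := by
  have hz : 0 < (z : ℂ).re := by simpa using hx.trans_lt hxz
  have hzx : 0 < ((z + x : ℝ) : ℂ).re := by simp; linarith
  have hzx' : 0 < ((z - x : ℝ) : ℂ).re := by simp; linarith
  have han : ∀ n : ℕ, 0 < (a + n).re := fun n => by simp; positivity
  set F : ℕ → ℝ → ℂ := fun n t =>
    (-x : ℂ) ^ n / n.factorial * tricomiIntegrand (a + n) (b + n) z t with hF
  have hFint : ∀ n, IntegrableOn (F n) (Ioi 0) := fun n =>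
    (tricomiIntegrand_integrableOn _ _ _ (han n) hz).const_mul _
  have hFnorm : ∀ n, ∀ t ∈ Ioi (0 : ℝ),
      ‖F n t‖ = (x * t) ^ n / n.factorial * ‖tricomiIntegrand a b z t‖ := by
    intro n t ht
    have ht' : (0 : ℝ) < t := ht
    simp only [hF, tricomiIntegrand_add_natCast a b z n ht', norm_mul, norm_div, norm_pow, norm_neg,
      Complex.norm_real, Complex.norm_natCast, Real.norm_of_nonneg hx, Real.norm_of_nonneg ht'.le]
    ring
  have hsum : Summable fun n => ∫ t in Ioi (0 : ℝ), ‖F n t‖ := by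
    refine summable_of_sum_le (c := ∫ t in Ioi (0 : ℝ), ‖tricomiIntegrand a b (z - x : ℝ) t‖)
      (fun n => integral_nonneg fun t => norm_nonneg _) fun s => ?_
    rw [← integral_finsetSum _ fun n _ => (hFint n).norm]
    refine setIntegral_mono_on (integrable_finsetSum _ fun n _ => (hFint n).norm)
      (tricomiIntegrand_integrableOn a b _ ha hzx').norm measurableSet_Ioi fun t ht => ?_
    have ht' : (0 : ℝ) < t := ht
    rw [Finset.sum_congr rfl fun n _ => hFnorm n t ht, ← Finset.sum_mul]
    have hle : ∑ n ∈ s, (x * t) ^ n / n.factorial ≤ Real.exp (x * t) := by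
      rw [Real.exp_eq_exp_ℝ, NormedSpace.exp_eq_tsum_div]
      exact (Real.summable_pow_div_factorial (x * t)).sum_le_tsum s fun n _ => by positivity
    refine (mul_le_mul_of_nonneg_right hle (norm_nonneg _)).trans_eq ?_
    rw [tricomiIntegrand_norm _ _ _ ht', tricomiIntegrand_norm _ _ _ ht', ← mul_assoc, ← mul_assoc,
      ← Real.exp_add]
    simp only [Complex.ofReal_re]
    ring_nf
  have key := hasSum_integral_of_summable_integral_norm hFint hsum
  have hlim : ∫ t in Ioi (0 : ℝ), ∑' n, F n t =
      ∫ t in Ioi (0 : ℝ), tricomiIntegrand a b (z + x : ℝ) t := by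
    refine setIntegral_congr_fun measurableSet_Ioi fun t ht => ?_
    have e : ∀ n, F n t = (-(x * t : ℂ)) ^ n / n.factorial * tricomiIntegrand a b z t := fun n => by
      simp only [hF, tricomiIntegrand_add_natCast a b z n ht, ← neg_mul, mul_pow]
      ring
    simp only [e]
    rw [tsum_mul_right, ← NormedSpace.exp_eq_tsum_div (𝔸 := ℂ) |> fun h => congrFun h _,
      ← Complex.exp_eq_exp_ℂ]
    simp only [tricomiIntegrand]
    rw [← mul_assoc, ← mul_assoc, ← Complex.exp_add]
    push_cast
    ring_nf
  rw [hlim] at key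
  rw [tricomiU_eq_integral _ _ _ ha hzx, tricomiIntegral]
  refine (key.mul_left (Complex.Gamma a)⁻¹).congr_fun fun n => ?_
  rw [tricomiU_eq_integral _ _ _ (han n) hz, tricomiIntegral]
  simp only [hF]
  rw [integral_const_mul, inv_Gamma_eq_ascPochhammer_mul a n]
  ring

/-- The Taylor expansion of `U(a, b, ·)` at `z > 0`. -/
theorem hasSum_tricomiU_add (a b : ℂ) {z x : ℝ} (hx : 0 ≤ x) (hxz : x < z) :
    HasSum (fun n : ℕ => (-x : ℂ) ^ n / n.factorial *
        ((ascPochhammer ℂ n).eval a * tricomiU (a + n) (b + n) z))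
      (tricomiU a b (z + x : ℝ)) := by
  -- Induction on N with Re a > -N: the series at a is assembled from those at (a+1, b+1) and (a+1,
  -- b).
  obtain ⟨N, hN⟩ := exists_nat_gt (-a.re)
  induction N generalizing a b with
  | zero => exact hasSum_tricomiU_add_of_re_pos a b (by simpa using hN) hx hxz
  | succ N ih =>
    have hz : 0 < (z : ℂ).re := by simpa using hx.trans_lt hxz
    have hzx : 0 < ((z + x : ℝ) : ℂ).re := by simp; linarith
    have hN' : -(a + 1).re < N := by push_cast at hN; simp; linarith
    have h1 := ih (a + 1) (b + 1) hN'
    have h2 := ih (a + 1) b hN'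
    -- The series for x U(a+1, b+1, z+x), reindexed by one to match powers of x. The factor n kills
    -- the term n = 0, where n - 1 is truncated.
    have h3 : HasSum (fun n : ℕ => -(n : ℂ) * ((-x : ℂ) ^ n / n.factorial *
        ((ascPochhammer ℂ (n - 1)).eval (a + 1) * tricomiU (a + n) (b + n) z)))
        (x * tricomiU (a + 1) (b + 1) (z + x : ℝ)) := by
      refine (hasSum_nat_add_iff' 1).1 ?_
      simp only [Finset.sum_range_one, Nat.cast_zero, neg_zero, zero_mul, sub_zero]
      refine (h1.mul_left (x : ℂ)).congr_fun fun n => ?_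
      rw [Nat.factorial_succ, Nat.add_sub_cancel, pow_succ]
      push_cast
      have : (n : ℂ) + 1 ≠ 0 := by exact_mod_cast n.succ_ne_zero
      rw [show a + (n + 1 : ℂ) = a + 1 + n by ring, show b + (n + 1 : ℂ) = b + 1 + n by ring]
      field_simp
    rw [← tricomiU_eq_raise_left a b _ hzx]
    have h4 := ((h1.mul_left (z : ℂ)).add h3).sub (h2.mul_left (b - a - 1))
    rw [← add_mul, ← Complex.ofReal_add] at h4
    refine h4.congr_fun fun n => ?_
    -- With this identity, the raising relation at (a+n, b+n, z) matches the series term by term; b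
    -- - a - 1 does not depend on n.
    have hp : (ascPochhammer ℂ n).eval a =
        (ascPochhammer ℂ n).eval (a + 1) - n * (ascPochhammer ℂ (n - 1)).eval (a + 1) := by
      cases n with
      | zero => simp
      | succ n =>
        rw [ascPochhammer_eval_succ_left, ascPochhammer_succ_eval, Nat.add_sub_cancel]
        push_cast
        ring
    have e := tricomiU_eq_raise_left (a + n) (b + n) z hz
    rw [show b + n - (a + n) - 1 = b - a - 1 by ring, show a + n + 1 = a + 1 + (n : ℂ) by ring,
      show b + n + 1 = b + 1 + (n : ℂ) by ring] at e
    rw [hp, ← e]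
    ring

/-! ### Estimates for absolute convergence -/

/-- Since Re a ≥ 1, t^{Re a - 1} ≤ (1+t)^{Re a - 1}. With s = 1 + t the integral is at most e^z ∫₁^∞
e^{-zs} s^{Re b - 2} ds, and extending to (0, ∞) gives a Gamma integral. -/
theorem norm_tricomiU_le {a b : ℂ} (ha : 1 ≤ a.re) (hb : 1 < b.re) {z : ℝ} (hz : 0 < z) :
    ‖tricomiU a b z‖ ≤ ‖(Complex.Gamma a)⁻¹‖ *
      (Real.exp z * ((1 / z) ^ (b.re - 1) * Real.Gamma (b.re - 1))) := by
  have hz' : 0 < (z : ℂ).re := by simpa using hz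
  have ha0 : 0 < a.re := by linarith
  rw [tricomiU_eq_integral _ _ _ ha0 hz', tricomiIntegral, norm_mul]
  refine mul_le_mul_of_nonneg_left ?_ (norm_nonneg _)
  set g : ℝ → ℝ := fun s => s ^ (b.re - 1 - 1) * Real.exp (-(z * s)) with hg
  have hval := Real.integral_rpow_mul_exp_neg_mul_Ioi (a := b.re - 1) (by linarith) hz
  have hpos : 0 < (1 / z) ^ (b.re - 1) * Real.Gamma (b.re - 1) :=
    mul_pos (by positivity) (Real.Gamma_pos_of_pos (by linarith))
  have hgint : IntegrableOn g (Ioi 0) := by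
    -- A non-integrable function would have integral 0 by convention.
    refine .of_integral_ne_zero ?_
    rw [hval]
    exact hpos.ne'
  have hmp := measurePreserving_add_right (volume : Measure ℝ) 1
  have hemb := measurableEmbedding_addRight (1 : ℝ)
  have hpre : (fun t : ℝ => t + 1) ⁻¹' Ioi 1 = Ioi 0 := by simp
  have hshift : ∫ t in Ioi (0 : ℝ), g (t + 1) = ∫ s in Ioi 1, g s := by
    rw [← hpre]; exact hmp.setIntegral_preimage_emb hemb g (Ioi 1)
  have hsub : Ioi (1 : ℝ) ⊆ Ioi 0 := Ioi_subset_Ioi zero_le_one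
  have hgint' : IntegrableOn (fun t => g (t + 1)) (Ioi 0) := by
    rw [← hpre]; exact (hmp.integrableOn_comp_preimage hemb).2 (hgint.mono_set hsub)
  calc ‖∫ t in Ioi (0 : ℝ), tricomiIntegrand a b z t‖
      ≤ ∫ t in Ioi (0 : ℝ), ‖tricomiIntegrand a b z t‖ := norm_integral_le_integral_norm _
    _ ≤ ∫ t in Ioi (0 : ℝ), Real.exp z * g (t + 1) := by
      refine setIntegral_mono_on (tricomiIntegrand_integrableOn a b _ ha0 hz').norm
        (hgint'.const_mul _) measurableSet_Ioi fun t ht => ?_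
      have ht' : (0 : ℝ) < t := ht
      rw [tricomiIntegrand_norm _ _ _ ht', hg]
      have h1 : t ^ (a.re - 1) ≤ (1 + t) ^ (a.re - 1) :=
        Real.rpow_le_rpow ht'.le (by linarith) (by linarith)
      have h2 : (1 + t) ^ (a.re - 1) * (1 + t) ^ (b.re - a.re - 1) = (t + 1) ^ (b.re - 1 - 1) := by
        rw [← Real.rpow_add (by linarith)]; ring_nf
      have h3 : Real.exp z * Real.exp (-(z * (t + 1))) = Real.exp (-z * t) := by
        rw [← Real.exp_add]; ring_nf
      have h4 : 0 ≤ (1 + t) ^ (b.re - a.re - 1) := by positivity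
      calc Real.exp (-(z : ℂ).re * t) * t ^ (a.re - 1) * (1 + t) ^ (b.re - a.re - 1)
          ≤ Real.exp (-z * t) * (1 + t) ^ (a.re - 1) * (1 + t) ^ (b.re - a.re - 1) := by
            rw [Complex.ofReal_re]; gcongr
        _ = _ := by rw [mul_assoc, h2, ← h3]; ring
    _ = Real.exp z * ∫ s in Ioi 1, g s := by rw [integral_const_mul, hshift]
    _ ≤ Real.exp z * ∫ s in Ioi 0, g s := by
      refine mul_le_mul_of_nonneg_left (setIntegral_mono_set hgint ?_ hsub.eventuallyLE)
        (Real.exp_pos _).le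
      refine (ae_restrict_iff' measurableSet_Ioi).2 (Eventually.of_forall fun s hs => ?_)
      have hs' : (0 : ℝ) < s := hs
      simp only [hg, Pi.zero_apply]
      positivity
    _ = _ := by rw [hval]

lemma re_add_natCast_le_norm (b : ℂ) (n : ℕ) : b.re + n ≤ ‖b + n‖ := by
  simpa using Complex.re_le_norm (b + n)

lemma ascPochhammer_eval_re_le_norm {b : ℂ} (hb : 0 < b.re) (n : ℕ) :
    (ascPochhammer ℝ n).eval b.re ≤ ‖(ascPochhammer ℂ n).eval b‖ := by
  induction n with
  | zero => simp
  | succ n ih =>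
    rw [ascPochhammer_succ_eval, ascPochhammer_succ_eval, norm_mul]
    exact mul_le_mul ih (re_add_natCast_le_norm b n) (by positivity) (norm_nonneg _)

/-- Factor by factor, |a+j| ≤ |a| + j ≤ K (Re b + j), using K ≥ 1. -/
lemma norm_ascPochhammer_div_le {a b : ℂ} (hb : 0 < b.re) {K : ℝ} (hK : 1 ≤ K)
    (hab : ‖a‖ ≤ K * b.re) (n : ℕ) :
    ‖(ascPochhammer ℂ n).eval a / (ascPochhammer ℂ n).eval b‖ ≤ K ^ n := by
  induction n with
  | zero => simp
  | succ n ih =>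
    rw [ascPochhammer_succ_eval, ascPochhammer_succ_eval, mul_div_mul_comm, norm_mul, pow_succ]
    refine mul_le_mul ih ?_ (norm_nonneg _) (by positivity)
    have h := re_add_natCast_le_norm b n
    have hn : (0 : ℝ) ≤ n := n.cast_nonneg
    rw [norm_div, div_le_iff₀ (by linarith)]
    calc ‖a + n‖ ≤ ‖a‖ + n := (norm_add_le _ _).trans_eq (by simp)
      _ ≤ K * (b.re + n) := by nlinarith
      _ ≤ K * ‖b + n‖ := by gcongr

lemma Gamma_add_natCast_eq {s : ℝ} (hs : 0 < s) (n : ℕ) :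
    Real.Gamma (s + n) = (ascPochhammer ℝ n).eval s * Real.Gamma s := by
  induction n with
  | zero => simp
  | succ n ih =>
    push_cast
    rw [← add_assoc, Real.Gamma_add_one (by positivity), ih, ascPochhammer_succ_eval]
    ring

lemma summable_pow_mul_Gamma_div_factorial {q s : ℝ} (hq : 0 < q) (hq1 : q < 1) (hs : 0 < s) :
    Summable fun ℓ : ℕ => q ^ ℓ * Real.Gamma (s + ℓ) / ℓ.factorial := by
  have hpos : ∀ ℓ : ℕ, 0 < q ^ ℓ * Real.Gamma (s + ℓ) / ℓ.factorial := fun ℓ => by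
    have := Real.Gamma_pos_of_pos (s := s + ℓ) (by positivity)
    positivity
  refine summable_of_ratio_test_tendsto_lt_one hq1 (Eventually.of_forall fun ℓ => (hpos ℓ).ne') ?_
  -- The ratio of consecutive terms is q (s+ℓ)/(ℓ+1).
  have h : Tendsto (fun ℓ : ℕ => q * (1 + (s - 1) * (1 / ((ℓ : ℝ) + 1)))) atTop (𝓝 q) := by
    simpa using ((tendsto_one_div_add_atTop_nhds_zero_nat (𝕜 := ℝ)).const_mul (s - 1)
      |>.const_add 1).const_mul q
  refine h.congr fun ℓ => ?_
  rw [Real.norm_of_nonneg (hpos _).le, Real.norm_of_nonneg (hpos _).le, Nat.factorial_succ]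
  push_cast
  rw [← add_assoc, Real.Gamma_add_one (by positivity)]
  have h1 : Real.Gamma (s + ℓ) ≠ 0 := (Real.Gamma_pos_of_pos (by positivity)).ne'
  have h2 : (ℓ : ℝ) + 1 ≠ 0 := by positivity
  field_simp
  ring

/-- The factor multiplying `₁F₁(a + ℓ; b + 2ℓ; x)` in the addition theorem for `U(a, b, z + x)`. -/
def additionCoeff (a b : ℂ) (z x : ℝ) (ℓ : ℕ) : ℂ :=
  (-1) ^ ℓ * ((ascPochhammer ℂ ℓ).eval a /
    ((ascPochhammer ℂ ℓ).eval (b + ℓ - 1) * (ℓ.factorial : ℂ))) * ((x : ℂ) * z) ^ ℓ *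
    tricomiU (a + ℓ) (b + 2 * ℓ) z

/-- In the bound for U, (a)_ℓ/Γ(a+ℓ) collapses to 1/Γ(a), the denominator (b+ℓ-1)_ℓ absorbs the
Pochhammer part of Γ(Re b - 1 + 2ℓ), and (xz)^ℓ z^{-2ℓ} = (x/z)^ℓ. -/
lemma summable_norm_additionCoeff (a : ℂ) {b : ℂ} (hb : 1 < b.re) {z x : ℝ} (hx : 0 < x)
    (hxz : x < z) : Summable fun ℓ => ‖additionCoeff a b z x ℓ‖ := by
  have hz : 0 < z := hx.trans hxz
  have hsum := summable_pow_mul_Gamma_div_factorial (q := x / z) (s := b.re - 1) (by positivity)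
    ((div_lt_one hz).2 hxz) (by linarith)
  refine (hsum.mul_left (‖(Complex.Gamma a)⁻¹‖ * Real.exp z * (1 / z) ^ (b.re - 1)))
    |>.of_norm_bounded_eventually_nat ?_
  -- From L on, Re (a+ℓ) ≥ 1, as the bound for U requires.
  obtain ⟨L, hL⟩ := exists_nat_ge (1 - a.re)
  filter_upwards [eventually_ge_atTop L] with ℓ hℓ
  have hℓ' : (L : ℝ) ≤ ℓ := by exact_mod_cast hℓ
  have hℓ0 : (0 : ℝ) ≤ ℓ := ℓ.cast_nonneg
  have hU := norm_tricomiU_le (a := a + ℓ) (b := b + 2 * ℓ) (by simp; linarith)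
    (by simp; linarith) hz
  have hre : (b + 2 * ℓ).re - 1 = b.re - 1 + ℓ + ℓ := by simp; ring
  have hre' : (b + ℓ - 1).re = b.re - 1 + ℓ := by simp; ring
  have hpos : 0 < b.re - 1 + ℓ := by linarith
  have hden := ascPochhammer_eval_re_le_norm (hre' ▸ hpos) ℓ
  rw [hre, Gamma_add_natCast_eq hpos, add_assoc (b.re - 1), Real.rpow_add (by positivity),
    ← Nat.cast_add, Real.rpow_natCast] at hU
  rw [hre'] at hden
  set P := (ascPochhammer ℝ ℓ).eval (b.re - 1 + ℓ)
  have hP : 0 < P := ascPochhammer_pos ℓ _ hpos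
  have hG : 0 < Real.Gamma (b.re - 1 + ℓ) := Real.Gamma_pos_of_pos hpos
  rw [norm_norm, additionCoeff, inv_Gamma_eq_ascPochhammer_mul a ℓ]
  simp only [norm_mul, norm_div, norm_pow, norm_neg, norm_one, one_pow, one_mul, Complex.norm_real,
    Complex.norm_natCast, Real.norm_of_nonneg hx.le, Real.norm_of_nonneg hz.le]
  calc ‖(ascPochhammer ℂ ℓ).eval a‖ / (‖(ascPochhammer ℂ ℓ).eval (b + ℓ - 1)‖ * ℓ.factorial) *
        (x * z) ^ ℓ * ‖tricomiU (a + ℓ) (b + 2 * ℓ) z‖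
      ≤ ‖(ascPochhammer ℂ ℓ).eval a‖ / (P * ℓ.factorial) * (x * z) ^ ℓ *
        (‖(Complex.Gamma (a + ℓ))⁻¹‖ * (Real.exp z * ((1 / z) ^ (b.re - 1) * (1 / z) ^ (ℓ + ℓ) *
          (P * Real.Gamma (b.re - 1 + ℓ))))) := by gcongr
    _ = _ := by
      rw [pow_add, div_pow, div_pow, mul_pow, one_pow]
      field_simp

/-! ### Rearrangement and the addition theorem -/

lemma ne_neg_natCast_of_re_pos {b : ℂ} (hb : 0 < b.re) (k : ℕ) : b ≠ -k := by
  rintro rfl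
  simp at hb
  linarith [k.cast_nonneg (α := ℝ)]

lemma norm_kummerM_term_le {a b : ℂ} (hb : 0 < b.re) {K : ℝ} (hK : 1 ≤ K) (hab : ‖a‖ ≤ K * b.re)
    {x : ℝ} (hx : 0 ≤ x) (m : ℕ) :
    ‖(ascPochhammer ℂ m).eval a / ((ascPochhammer ℂ m).eval b * (m.factorial : ℂ)) * (x : ℂ) ^ m‖ ≤
      (K * x) ^ m / m.factorial := by
  rw [← div_div, norm_mul, norm_div, norm_pow, Complex.norm_natCast, Complex.norm_real,
    Real.norm_of_nonneg hx, mul_pow, mul_div_right_comm]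
  gcongr
  exact norm_ascPochhammer_div_le hb hK hab m

/-- Matches entry (ℓ, m) of the double series with the ℓ-th part of Taylor term n = ℓ + m. The
splitting (b+ℓ-1)_{n+1} = (b+ℓ-1)_ℓ (b+2ℓ-1) (b+2ℓ)_m cancels the numerator b+2ℓ-1 of
`expansionCoeff`. -/
lemma additionCoeff_mul_kummerM_term (a : ℂ) {b : ℂ} (hb : 1 < b.re) (z x : ℝ) (ℓ m : ℕ) :
    additionCoeff a b z x ℓ * ((ascPochhammer ℂ m).eval (a + ℓ) /
      ((ascPochhammer ℂ m).eval (b + 2 * ℓ) * (m.factorial : ℂ)) * (x : ℂ) ^ m) =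
    (x : ℂ) ^ (ℓ + m) / (ℓ + m).factorial * (ascPochhammer ℂ (ℓ + m)).eval a *
      (expansionCoeff (ℓ + m) ℓ b * ((-z : ℂ) ^ ℓ * tricomiU (a + ℓ) (b + 2 * ℓ) z)) := by
  have hℓ0 : (0 : ℝ) ≤ ℓ := ℓ.cast_nonneg
  have h1 := ascPochhammer_eval_ne_zero (b := b + ℓ - 1) (by simp; linarith) ℓ
  have h2 := ascPochhammer_eval_ne_zero (b := b + 2 * ℓ) (by simp; linarith) m
  have h3 : b + 2 * ℓ - 1 ≠ 0 := fun h => by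
    have := congrArg Complex.re h
    simp at this
    linarith
  have hc : (((ℓ + m).choose ℓ : ℕ) : ℂ) * ℓ.factorial * m.factorial = (ℓ + m).factorial := by
    have := Nat.choose_mul_factorial_mul_factorial (Nat.le_add_right ℓ m)
    rw [Nat.add_sub_cancel_left] at this
    exact_mod_cast this
  have f1 : (ℓ.factorial : ℂ) ≠ 0 := by exact_mod_cast ℓ.factorial_ne_zero
  have f2 : (m.factorial : ℂ) ≠ 0 := by exact_mod_cast m.factorial_ne_zero
  have f3 : (((ℓ + m).choose ℓ : ℕ) : ℂ) ≠ 0 := by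
    exact_mod_cast (Nat.choose_pos (Nat.le_add_right ℓ m)).ne'
  have hp : (ascPochhammer ℂ (ℓ + m + 1)).eval (b + ℓ - 1) =
      (ascPochhammer ℂ ℓ).eval (b + ℓ - 1) *
        ((b + 2 * ℓ - 1) * (ascPochhammer ℂ m).eval (b + 2 * ℓ)) := by
    rw [add_assoc, ascPochhammer_eval_add, ascPochhammer_eval_succ_left]
    ring_nf
  rw [additionCoeff, expansionCoeff, hp, ← hc, ascPochhammer_eval_add ℓ m a, neg_pow (z : ℂ),
    mul_pow, pow_add]
  generalize (ascPochhammer ℂ m).eval (b + 2 * ℓ) = Q at *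
  generalize b + 2 * ℓ - 1 = d at *
  field_simp

/-- The addition theorem for `U(a, b, z + x)`. -/
theorem hasSum_additionCoeff_mul_kummerM (a : ℂ) {b : ℂ} (hb : 1 < b.re) {z x : ℝ} (hx : 0 < x)
    (hxz : x < z) :
    HasSum (fun ℓ : ℕ => additionCoeff a b z x ℓ * kummerM (a + ℓ) (b + 2 * ℓ) x)
      (tricomiU a b (z + x : ℝ)) := by
  have hz : 0 < (z : ℂ).re := by simpa using hx.trans hxz
  -- One constant for all rows: |a+ℓ| ≤ |a| + ℓ ≤ K (Re b + 2ℓ).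
  set K : ℝ := ‖a‖ + 1 with hK
  have hK1 : 1 ≤ K := by linarith [norm_nonneg a]
  have hbℓ : ∀ ℓ : ℕ, 0 < (b + 2 * ℓ).re := fun ℓ => by
    simp; linarith [ℓ.cast_nonneg (α := ℝ)]
  have haℓ : ∀ ℓ : ℕ, ‖a + ℓ‖ ≤ K * (b + 2 * ℓ).re := fun ℓ => by
    have h0 : (0 : ℝ) ≤ ℓ := ℓ.cast_nonneg
    have : ‖a + ℓ‖ ≤ ‖a‖ + ℓ := (norm_add_le _ _).trans_eq (by simp)
    simp only [Complex.add_re, Complex.mul_re, Complex.re_ofNat, Complex.im_ofNat,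
      Complex.natCast_re, Complex.natCast_im, mul_zero, sub_zero]
    nlinarith [norm_nonneg a]
  set t : ℕ → ℕ → ℂ := fun ℓ m => (ascPochhammer ℂ m).eval (a + ℓ) /
    ((ascPochhammer ℂ m).eval (b + 2 * ℓ) * (m.factorial : ℂ)) * (x : ℂ) ^ m with ht
  have htle : ∀ ℓ m, ‖t ℓ m‖ ≤ (K * x) ^ m / m.factorial := fun ℓ m =>
    norm_kummerM_term_le (hbℓ ℓ) hK1 (haℓ ℓ) hx.le m
  have hexp := Real.summable_pow_div_factorial (K * x)
  have hprod : Summable fun p : ℕ × ℕ => additionCoeff a b z x p.1 * t p.1 p.2 := by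
    refine Summable.of_norm_bounded ((summable_norm_additionCoeff a hb hx hxz).mul_of_nonneg hexp
      (fun _ => norm_nonneg _) (fun _ => by simp only [Pi.zero_apply]; positivity)) fun p => ?_
    rw [norm_mul]
    exact mul_le_mul_of_nonneg_left (htle _ _) (norm_nonneg _)
  have hrow : ∀ ℓ, HasSum (fun m => additionCoeff a b z x ℓ * t ℓ m)
      (additionCoeff a b z x ℓ * kummerM (a + ℓ) (b + 2 * ℓ) x) := fun ℓ => by
    rw [kummerM_eq_tsum _ _ _ (ne_neg_natCast_of_re_pos (hbℓ ℓ))]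
    exact (Summable.of_norm_bounded hexp (htle ℓ)).hasSum.mul_left _
  -- Rows sum to the ₁F₁ series, antidiagonals to the Taylor terms; uniqueness of the sum identifies
  -- the totals.
  have htotal := hprod.hasSum.prod_fiberwise hrow
  have hdiag := (Finset.HasAntidiagonal.sigmaAntidiagonalEquivProd (A := ℕ)).hasSum_iff.2
    hprod.hasSum |>.sigma fun n => hasSum_fintype _
  have hterm : ∀ n : ℕ, ∑ p : Finset.HasAntidiagonal.antidiagonal n,
      additionCoeff a b z x (p : ℕ × ℕ).1 * t (p : ℕ × ℕ).1 (p : ℕ × ℕ).2 =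
      (-x : ℂ) ^ n / n.factorial * ((ascPochhammer ℂ n).eval a * tricomiU (a + n) (b + n) z) := by
    intro n
    rw [Finset.sum_coe_sort (Finset.HasAntidiagonal.antidiagonal n)
      fun p => additionCoeff a b z x p.1 * t p.1 p.2]
    have e : ∀ p ∈ Finset.HasAntidiagonal.antidiagonal n, additionCoeff a b z x p.1 * t p.1 p.2 =
        (x : ℂ) ^ n / n.factorial * (ascPochhammer ℂ n).eval a *
        (expansionCoeff n p.1 b * ((-z : ℂ) ^ p.1 * tricomiU (a + p.1) (b + 2 * p.1) z)) := by
      intro p hp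
      rw [← Finset.HasAntidiagonal.mem_antidiagonal.1 hp]
      exact additionCoeff_mul_kummerM_term a hb z x p.1 p.2
    rw [Finset.sum_congr rfl e, ← Finset.mul_sum, Finset.Nat.sum_antidiagonal_eq_sum_range_succ_mk]
    rw [sum_expansionCoeff_mul_tricomiU n a b z hb hz, neg_pow (x : ℂ)]
    ring
  rw [← ((hasSum_tricomiU_add a b hx.le hxz).congr_fun hterm).unique hdiag] at htotal
  exact htotal

/-! ### Behaviour as x ↓ 0 -/

/-- Dominated convergence in the Taylor series, whose terms for 0 < x < z/2 are bounded by those at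
x = z/2. -/
lemma tendsto_tricomiU_add (a b : ℂ) {z : ℝ} (hz : 0 < z) :
    Tendsto (fun x : ℝ => tricomiU a b (z + x : ℝ)) (𝓝[>] 0) (𝓝 (tricomiU a b z)) := by
  have hz2 : 0 ≤ z / 2 := by positivity
  have hs := (hasSum_tricomiU_add a b hz2 (by linarith : z / 2 < z)).summable.norm
  have h0 := (hasSum_tricomiU_add a b le_rfl hz).tsum_eq
  rw [add_zero] at h0
  rw [← h0]
  have hmem : ∀ᶠ x : ℝ in 𝓝[>] 0, 0 < x ∧ x < z / 2 := by
    filter_upwards [Ioo_mem_nhdsGT (by positivity : 0 < z / 2)] with x hx using hx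
  refine (tendsto_tsum_of_dominated_convergence hs (fun n => ?_) ?_).congr' ?_ (f₁ := fun x : ℝ =>
    ∑' n : ℕ, (-x : ℂ) ^ n / n.factorial *
      ((ascPochhammer ℂ n).eval a * tricomiU (a + n) (b + n) z))
  · exact (Continuous.tendsto (by fun_prop : Continuous fun x : ℝ => (-x : ℂ) ^ n / n.factorial *
      ((ascPochhammer ℂ n).eval a * tricomiU (a + n) (b + n) z)) 0).mono_left nhdsWithin_le_nhds
  · filter_upwards [hmem] with x hx n
    simp only [norm_mul, norm_div, norm_pow, norm_neg, Complex.norm_real,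
      Real.norm_of_nonneg hx.1.le, Real.norm_of_nonneg hz2]
    have := hx.1.le
    gcongr
    exact hx.2.le
  · filter_upwards [hmem] with x hx
    exact (hasSum_tricomiU_add a b hx.1.le (by linarith [hx.2])).tsum_eq

lemma kummerM_continuous (a b : ℂ) : Continuous (kummerM a b) := by
  refine Continuous.mul continuous_const ?_
  have hr : (Complex.regularizedHGFunSeries {a} {b}).radius = ⊤ :=
    Complex.radius_regularizedHGFunSeries_eq_top (by simp)
  have h := ((Complex.regularizedHGFunSeries {a} {b}).hasFPowerSeriesOnBall
    (by simp [hr])).continuousOn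
  rw [hr, Metric.eball_top] at h
  exact continuousOn_univ.1 h

lemma kummerM_zero (a : ℂ) {b : ℂ} (hb : 0 < b.re) : kummerM a b 0 = 1 := by
  rw [kummerM_eq_tsum a b 0 (ne_neg_natCast_of_re_pos hb), tsum_eq_single 0 fun n hn => by simp [hn]]
  simp

/-! ### Translation to Whittaker functions -/

lemma summand_eq (κ μ : ℂ) {r r₀ : ℝ} (hr : 0 < r) (hr₀ : 0 < r₀) (ℓ : ℕ) :
    summand κ μ r r₀ ℓ = ((r * r₀ : ℝ) : ℂ) ^ (μ + 1 / 2) * (Complex.exp (-(r + r₀ : ℝ) / 2) *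
      (additionCoeff (μ - κ + 1 / 2) (2 * μ + 1) r r₀ ℓ *
        kummerM (μ - κ + 1 / 2 + ℓ) (2 * μ + 1 + 2 * ℓ) r₀)) := by
  have h1 : (r : ℂ) ≠ 0 := by exact_mod_cast hr.ne'
  have h2 : (r₀ : ℂ) ≠ 0 := by exact_mod_cast hr₀.ne'
  have e : Complex.exp (-(r + r₀ : ℝ) / 2) = Complex.exp (-r₀ / 2) * Complex.exp (-r / 2) := by
    rw [← Complex.exp_add]; push_cast; ring_nf
  rw [e, Complex.ofReal_mul, Complex.mul_cpow_ofReal_nonneg hr.le hr₀.le, summand, whittakerM,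
    whittakerW, additionCoeff, show 1 / 2 + (ℓ + μ) = μ + 1 / 2 + ℓ by ring,
    Complex.cpow_add _ _ h1, Complex.cpow_add _ _ h2, Complex.cpow_natCast, Complex.cpow_natCast,
    show ℓ + μ - κ + 1 / 2 = μ - κ + 1 / 2 + ℓ by ring,
    show 2 * (ℓ + μ) + 1 = 2 * μ + 1 + 2 * ℓ by ring,
    show 2 * μ + 1 + ℓ - 1 = ℓ + 2 * μ by ring]
  ring

lemma one_div_cpow_mul_whittakerW (κ μ : ℂ) {s : ℝ} (hs : 0 < s) :
    1 / (s : ℂ) ^ (μ + 1 / 2) * whittakerW κ μ s =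
      Complex.exp (-s / 2) * tricomiU (μ - κ + 1 / 2) (2 * μ + 1) s := by
  have h : (s : ℂ) ^ (μ + 1 / 2) ≠ 0 := by
    simp [Complex.cpow_eq_zero_iff, hs.ne']
  rw [whittakerW, add_comm (1 / 2) μ, mul_comm (Complex.exp _), mul_assoc, ← mul_assoc,
    one_div_mul_cancel h, one_mul]

lemma hasSum_summand (κ μ : ℂ) (hμ : 0 < μ.re) {r r₀ : ℝ} (hr₀ : 0 < r₀) (h : r₀ < r) :
    HasSum (summand κ μ r r₀) (((r * r₀ : ℝ) : ℂ) ^ (μ + 1 / 2) *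
      (1 / ((r + r₀ : ℝ) : ℂ) ^ (μ + 1 / 2) * whittakerW κ μ (r + r₀))) := by
  have hr : 0 < r := hr₀.trans h
  rw [one_div_cpow_mul_whittakerW κ μ (by positivity : 0 < r + r₀)]
  exact (((hasSum_additionCoeff_mul_kummerM _ (by simpa using hμ) hr₀ h).mul_left _).mul_left
    _).congr_fun fun ℓ => summand_eq κ μ hr hr₀ ℓ

lemma one_div_cpow_mul_tsum_summand (κ μ : ℂ) (hμ : 0 < μ.re) {r r₀ : ℝ} (hr₀ : 0 < r₀)
    (h : r₀ < r) :
    1 / ((r * r₀ : ℝ) : ℂ) ^ (μ + 1 / 2) * ∑' ℓ : ℕ, summand κ μ r r₀ ℓ =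
      1 / ((r + r₀ : ℝ) : ℂ) ^ (μ + 1 / 2) * whittakerW κ μ (r + r₀) := by
  have hne : ((r * r₀ : ℝ) : ℂ) ^ (μ + 1 / 2) ≠ 0 := by
    simp [Complex.cpow_eq_zero_iff, hr₀.ne', (hr₀.trans h).ne']
  rw [(hasSum_summand κ μ hμ hr₀ h).tsum_eq, ← mul_assoc, one_div_mul_cancel hne, one_mul]

lemma tendsto_one_div_cpow_mul_whittakerW (κ μ : ℂ) {r : ℝ} (hr : 0 < r) :
    Tendsto (fun r₀ : ℝ => 1 / ((r + r₀ : ℝ) : ℂ) ^ (μ + 1 / 2) * whittakerW κ μ (r + r₀))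
      (𝓝[>] 0) (𝓝 (1 / (r : ℂ) ^ (μ + 1 / 2) * whittakerW κ μ r)) := by
  rw [one_div_cpow_mul_whittakerW κ μ hr]
  have he : Tendsto (fun r₀ : ℝ => Complex.exp (-(r + r₀ : ℝ) / 2)) (𝓝[>] 0)
      (𝓝 (Complex.exp (-r / 2))) := by
    have := (by fun_prop : Continuous fun r₀ : ℝ => Complex.exp (-(r + r₀ : ℝ) / 2)).tendsto 0
    rw [add_zero] at this
    exact this.mono_left nhdsWithin_le_nhds
  refine (he.mul (tendsto_tricomiU_add _ _ hr)).congr' ?_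
  filter_upwards [self_mem_nhdsWithin] with r₀ (h : 0 < r₀)
  exact (one_div_cpow_mul_whittakerW κ μ (by positivity)).symm

/-- Once the power (r r₀)^{μ+1/2} is cancelled, the term is continuous in r₀ up to 0, where ₁F₁
equals 1. -/
lemma tendsto_one_div_cpow_mul_summand (κ μ : ℂ) (hμ : 0 < μ.re) {r : ℝ} (hr : 0 < r) (ℓ : ℕ) :
    Tendsto (fun r₀ : ℝ => 1 / ((r * r₀ : ℝ) : ℂ) ^ (μ + 1 / 2) * summand κ μ r r₀ ℓ) (𝓝[>] 0)
      (𝓝 (Complex.exp (-r / 2) * additionCoeff (μ - κ + 1 / 2) (2 * μ + 1) r 0 ℓ)) := by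
  have hc : Continuous fun r₀ : ℝ => Complex.exp (-(r + r₀ : ℝ) / 2) *
      (additionCoeff (μ - κ + 1 / 2) (2 * μ + 1) r r₀ ℓ *
        kummerM (μ - κ + 1 / 2 + ℓ) (2 * μ + 1 + 2 * ℓ) r₀) := by
    have := (kummerM_continuous (μ - κ + 1 / 2 + ℓ) (2 * μ + 1 + 2 * ℓ)).comp
      Complex.continuous_ofReal
    simp only [additionCoeff]
    exact Continuous.mul (by fun_prop) (Continuous.mul (by fun_prop) this)
  have h := hc.tendsto 0
  rw [Complex.ofReal_zero, kummerM_zero _ (by simp; positivity), mul_one, add_zero] at h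
  refine (h.mono_left nhdsWithin_le_nhds).congr' ?_
  filter_upwards [self_mem_nhdsWithin] with r₀ (hr₀ : 0 < r₀)
  have hne : ((r * r₀ : ℝ) : ℂ) ^ (μ + 1 / 2) ≠ 0 := by
    simp [Complex.cpow_eq_zero_iff, hr₀.ne', hr.ne']
  rw [summand_eq κ μ hr hr₀, ← mul_assoc (1 / _), one_div_mul_cancel hne, one_mul]

/-- The factor (0 · r)^ℓ leaves only ℓ = 0. -/
lemma hasSum_exp_mul_additionCoeff_zero (κ μ : ℂ) {r : ℝ} (hr : 0 < r) :
    HasSum (fun ℓ => Complex.exp (-r / 2) * additionCoeff (μ - κ + 1 / 2) (2 * μ + 1) r 0 ℓ)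
      (1 / (r : ℂ) ^ (μ + 1 / 2) * whittakerW κ μ r) := by
  rw [one_div_cpow_mul_whittakerW κ μ hr]
  convert! hasSum_single (f := fun ℓ => Complex.exp (-r / 2) *
    additionCoeff (μ - κ + 1 / 2) (2 * μ + 1) r 0 ℓ) 0 fun ℓ hℓ => by
      simp [additionCoeff, hℓ] using 1
  simp [additionCoeff]

end Whittaker

end

theorem mainTheorem3 (κ μ : ℂ) (hμ : 0 < μ.re) (r : ℝ) (hr : 0 < r) :
    -- the identity for `0 < r₀ < r`
    (∀ r₀ : ℝ, 0 < r₀ → r₀ < r →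
      Summable (fun ℓ : ℕ => Whittaker.summand κ μ r r₀ ℓ) ∧
      1 / ((r * r₀ : ℝ) : ℂ) ^ (μ + 1 / 2) * ∑' ℓ : ℕ, Whittaker.summand κ μ r r₀ ℓ =
        1 / ((r + r₀ : ℝ) : ℂ) ^ (μ + 1 / 2) * Whittaker.whittakerW κ μ (r + r₀)) ∧
    -- the identity for `r₀ = 0`, as a limiting case: the left-hand side converges as `r₀ ↓ 0`
    -- to the value of the right-hand side at `r₀ = 0`, ...
    Tendsto (fun r₀ : ℝ => 1 / ((r * r₀ : ℝ) : ℂ) ^ (μ + 1 / 2) *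
        ∑' ℓ : ℕ, Whittaker.summand κ μ r r₀ ℓ) (𝓝[>] 0)
      (𝓝 (1 / (r : ℂ) ^ (μ + 1 / 2) * Whittaker.whittakerW κ μ r)) ∧
    -- ... and so does the series of the limits of its individual terms
    (∃ c : ℕ → ℂ,
      (∀ ℓ : ℕ, Tendsto (fun r₀ : ℝ => 1 / ((r * r₀ : ℝ) : ℂ) ^ (μ + 1 / 2) *
        Whittaker.summand κ μ r r₀ ℓ) (𝓝[>] 0) (𝓝 (c ℓ))) ∧
      HasSum c (1 / (r : ℂ) ^ (μ + 1 / 2) * Whittaker.whittakerW κ μ r)) := by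
  -- In ℂ, `Summable` amounts to absolute convergence.
  refine ⟨fun r₀ h0 h => ⟨(Whittaker.hasSum_summand κ μ hμ h0 h).summable,
      Whittaker.one_div_cpow_mul_tsum_summand κ μ hμ h0 h⟩, ?_,
    _, Whittaker.tendsto_one_div_cpow_mul_summand κ μ hμ hr,
    Whittaker.hasSum_exp_mul_additionCoeff_zero κ μ hr⟩
  refine (Whittaker.tendsto_one_div_cpow_mul_whittakerW κ μ hr).congr' ?_
  filter_upwards [Ioo_mem_nhdsGT hr] with r₀ h
  exact (Whittaker.one_div_cpow_mul_tsum_summand κ μ hμ h.1 h.2).symm
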